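/- Let $\mathbb{P}_2$ be the set of all positive definite complex $2\times 2$ matrices, with the topology inherited from any norm on the space of complex $2\times2$ matrices. A Jordan triple automorphism of $\mathbb{P}_2$ is a bijective map $\phi:\mathbb{P}_2\to\mathbb{P}_2$ such that $\phi(ABA)=\phi(A)\phi(B)\phi(A)$ for all $A,B\in\mathbb{P}_2$. **Theorem.** If $\phi:\mathbb{P}_2\to\mathbb{P}_2$ is a continuous Jordan triple automorphism, then $\phi$ is of one of the following two forms: 1. there are a real number $c\neq -1/2$ and $U\in\mathbf{SU}(2)$ such that $\phi(A)=(\operatorname{Det} A)^c\,UAU^*$ for all $A\in\mathbb{P}_2$; 2. there are a real number $d\neq 1/2$ and $V\in\mathbf{SU}(2)$ such that $\phi(A)=(\operatorname{Det} A)^d\,VA^{-1}V^*$ for all $A\in\mathbb{P}_2$. -/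

import Mathlib

open scoped ComplexOrder Matrix

namespace JordanTriple

/-- The set `ℙ n` of positive definite complex `n × n` matrices, with the subspace topology of the
matrix space (the topology of any norm on it). -/
abbrev PosDefMat (n : ℕ) : Type :=
  {A : Matrix (Fin n) (Fin n) ℂ // A.PosDef}

/-- The Jordan triple product of two positive definite matrices is positive definite. -/
theorem posDef_triple {n : ℕ} {A B : Matrix (Fin n) (Fin n) ℂ} (hA : A.PosDef) (hB : B.PosDef) :
    (A * B * A).PosDef := by
  have h := hB.conjTranspose_mul_mul_same (B := A)
    (Matrix.mulVec_injective_of_isUnit hA.isUnit)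
  rwa [hA.isHermitian.eq] at h

/-- The Jordan triple product `(A, B) ↦ A B A` on the positive definite matrices. -/
def triple {n : ℕ} (A B : PosDefMat n) : PosDefMat n :=
  ⟨A.1 * B.1 * A.1, posDef_triple A.2 B.2⟩

/-- A Jordan triple endomorphism: `φ (A B A) = φ A φ B φ A` for all `A`, `B`. -/
def IsJordanTripleEndomorphism {n : ℕ} (φ : PosDefMat n → PosDefMat n) : Prop :=
  ∀ A B : PosDefMat n, φ (triple A B) = triple (φ A) (φ B)

/-- A Jordan triple automorphism: a bijective Jordan triple endomorphism. -/
def IsJordanTripleAutomorphism {n : ℕ} (φ : PosDefMat n → PosDefMat n) : Prop :=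
  IsJordanTripleEndomorphism φ ∧ Function.Bijective φ

/-- The determinant of a positive definite matrix, as a real number. -/
noncomputable def Det {n : ℕ} (A : PosDefMat n) : ℝ :=
  A.1.det.re

/-- No information is lost by taking the real part. -/
theorem coe_Det {n : ℕ} (A : PosDefMat n) : ((Det A : ℝ) : ℂ) = A.1.det := by
  have h := Complex.pos_iff.1 A.2.det_pos
  exact Complex.ext rfl h.2

theorem Det_pos {n : ℕ} (A : PosDefMat n) : 0 < Det A :=
  (Complex.pos_iff.1 A.2.det_pos).1

end JordanTriple

/-!
Write a Hermitian `2 × 2` matrix as `a I + v · σ` with `v` in Euclidean `3`-space (`lorentz`). The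
positive definite matrices of determinant `1` are then the boosts `cosh s I + sinh s (n · σ)` with
`n` a unit vector (`boost`), a model of hyperbolic `3`-space in which `s` is the distance to `I` and
`n` the direction, and every positive definite matrix is a positive scalar times a boost.

The key is the behaviour of `A B A` for the long boosts `A = boost (t / 2) m` and `B = boost t n`
with `m ≠ -n` (`exists_tendsto_triple`): as `t → ∞`, its length is
`2 t + log ((1 + ⟪m, n⟫) / 2) + o(1)`, and its direction tends to `m`. A quantity that is continuous
and compatible with the triple product has the mean of its rates at `m` and `n` as its rate on
`A B A`, and in the limit this has to be its rate at `m`; so the rates at `m` and `n` agree. The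
argument is used twice:

* for `log (Det (φ A))`, whose rate is odd in the direction and hence vanishes, so that `φ` preserves
  the boosts (`Det_map_boost`);
* for the length of `φ A`. Since `φ` maps one-parameter groups of boosts to such groups
  (`exists_map_boost`), there is one factor `K` by which it stretches all lengths
  (`MapsBoosts.rate_eq`).

Comparing the bounded terms `log ((1 + ⟪m, n⟫) / 2)` before and after `φ` gives `K = 1` (from
orthogonal directions) and then that the induced map of directions preserves inner products
(`MapsBoosts.inner_map`). It is therefore the restriction of an orthogonal transformation of
`3`-space, which is `± U · U*` with `U ∈ SU(2)`, as conjugation by a traceless unitary is minus a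
reflection (`exists_conj_isometry`). The sign `-` turns a boost into its inverse.

Surjectivity serves to show that the image `T` of a scalar matrix is scalar: `T D² T = D T² D` for
every `D` in the image of `φ` (`exists_map_scal`). Hence `φ (exp s I) = exp (γ s) I`, and injectivity
gives `γ ≠ 0`, which excludes the exponents `-1 / 2` and `1 / 2`.
-/

namespace JordanTriple

/-! ### Lorentz coordinates on Hermitian `2 × 2` matrices -/

/-- Euclidean `3`-space, the coordinate space of the traceless Hermitian `2 × 2` matrices. -/
abbrev Space : Type := EuclideanSpace ℝ (Fin 3)

/-- Unit vectors of Euclidean `3`-space. -/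
abbrev UnitSphere : Type := Metric.sphere (0 : Space) 1

/-- The Hermitian matrix `a I + v · σ`, where `σ` is the triple of Pauli matrices. -/
noncomputable def lorentz (a : ℝ) (v : Space) : Matrix (Fin 2) (Fin 2) ℂ :=
  !![(a + v 2 : ℂ), v 0 - v 1 * Complex.I; v 0 + v 1 * Complex.I, a - v 2]

theorem inner_coord (v w : Space) : inner ℝ v w = v 0 * w 0 + v 1 * w 1 + v 2 * w 2 := by
  simp [PiLp.inner_apply, Fin.sum_univ_three, mul_comm]

theorem norm_sq_coord (v : Space) : ‖v‖ ^ 2 = v 0 ^ 2 + v 1 ^ 2 + v 2 ^ 2 := by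
  rw [← real_inner_self_eq_norm_sq, inner_coord]; ring

theorem lorentz_inj {a b : ℝ} {v w : Space} (h : lorentz a v = lorentz b w) : a = b ∧ v = w := by
  have e : ∀ i j, lorentz a v i j = lorentz b w i j := fun i j => by rw [h]
  have h00 := congrArg Complex.re (e 0 0)
  have h11 := congrArg Complex.re (e 1 1)
  have h10 := congrArg Complex.re (e 1 0)
  have h10' := congrArg Complex.im (e 1 0)
  simp [lorentz] at h00 h11 h10 h10'
  refine ⟨by linarith, ?_⟩
  ext i
  fin_cases i
  · exact h10
  · exact h10'
  · show v 2 = w 2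
    linarith

theorem lorentz_isHermitian (a : ℝ) (v : Space) : (lorentz a v).IsHermitian := by
  ext i j
  fin_cases i <;> fin_cases j <;> simp [lorentz, Complex.ext_iff]

theorem exists_lorentz {A : Matrix (Fin 2) (Fin 2) ℂ} (hA : A.IsHermitian) :
    ∃ a v, A = lorentz a v := by
  have h00 := congrArg Complex.im (hA.apply 0 0)
  have h11 := congrArg Complex.im (hA.apply 1 1)
  have h10 := congrArg Complex.im (hA.apply 1 0)
  have h10' := congrArg Complex.re (hA.apply 1 0)
  simp at h00 h11 h10 h10'
  refine ⟨((A 0 0).re + (A 1 1).re) / 2,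
    !₂[(A 1 0).re, (A 1 0).im, ((A 0 0).re - (A 1 1).re) / 2], ?_⟩
  ext i j
  fin_cases i <;> fin_cases j <;> simp [lorentz, Complex.ext_iff] <;>
    (try constructor) <;> linarith

theorem det_lorentz (a : ℝ) (v : Space) :
    (lorentz a v).det = ((a ^ 2 - ‖v‖ ^ 2 : ℝ) : ℂ) := by
  rw [Matrix.det_fin_two, norm_sq_coord]
  simp only [lorentz, Matrix.of_apply, Matrix.cons_val', Matrix.cons_val_zero, Matrix.cons_val_one,
    Matrix.cons_val_fin_one]
  push_cast
  linear_combination (v 1 : ℂ) ^ 2 * Complex.I_sq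

/-- The Jordan triple product in Lorentz coordinates; it is the Cayley–Hamilton identity
`A B A = tr (A B) A - det A • adj B`. -/
theorem lorentz_triple (a b : ℝ) (v w : Space) :
    lorentz a v * lorentz b w * lorentz a v =
      lorentz (a ^ 2 * b + b * ‖v‖ ^ 2 + 2 * a * inner ℝ v w)
        ((2 * (a * b + inner ℝ v w)) • v + (a ^ 2 - ‖v‖ ^ 2) • w) := by
  rw [inner_coord, norm_sq_coord]
  ext i j
  fin_cases i <;> fin_cases j <;>
  simp [lorentz, Matrix.mul_apply, Complex.ext_iff, pow_two] <;> 
    constructor <;> ring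

theorem lorentz_one_zero : lorentz 1 0 = 1 := by
  ext i j
  fin_cases i <;> fin_cases j <;> simp [lorentz]

theorem lorentz_smul (c a : ℝ) (v : Space) : lorentz (c * a) (c • v) = c • lorentz a v := by
  ext i j
  fin_cases i <;> fin_cases j <;> simp [lorentz] <;> ring

theorem lorentz_add (a b : ℝ) (v w : Space) :
    lorentz (a + b) (v + w) = lorentz a v + lorentz b w := by
  ext i j
  fin_cases i <;> fin_cases j <;> simp [lorentz] <;> ring

theorem continuous_lorentz : Continuous fun p : ℝ × Space => lorentz p.1 p.2 := by
  unfold lorentz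
  refine continuous_matrix fun i j => ?_
  fin_cases i <;> fin_cases j <;> simp <;> fun_prop

/-- The positive definite matrix `exp (s N) = cosh s I + sinh s N`, for the traceless Hermitian
matrix `N` with `N² = I` given by a unit vector. These are the matrices of determinant `1`. -/
noncomputable def boost (s : ℝ) (n : UnitSphere) : PosDefMat 2 :=
  ⟨lorentz (Real.cosh s) (Real.sinh s • n.1), by
    have hn : ‖n.1‖ = 1 := norm_eq_of_mem_sphere n
    set B := lorentz (Real.cosh (s / 2)) (Real.sinh (s / 2) • n.1) with hB
    have hdet : B.det = 1 := by
      rw [hB, det_lorentz, norm_smul, hn, mul_one, Real.norm_eq_abs, sq_abs, Real.cosh_sq]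
      simp
    have hunit : IsUnit B := by
      rw [Matrix.isUnit_iff_isUnit_det, hdet]; exact isUnit_one
    have h := (Matrix.PosDef.one (n := Fin 2) (R := ℂ)).conjTranspose_mul_mul_same (B := B)
      (Matrix.mulVec_injective_of_isUnit hunit)
    rw [(lorentz_isHermitian _ _ : B.IsHermitian).eq, ← lorentz_one_zero, hB, lorentz_triple] at h
    have e := Real.cosh_two_mul (s / 2)
    have e' := Real.sinh_two_mul (s / 2)
    rw [mul_div_cancel₀ s two_ne_zero] at e e'
    convert h using 2
    · rw [e, norm_smul, hn]; simp
    · rw [e', smul_smul]; simp; ring_nf⟩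

/-- The positive scalar matrix `exp s I`. -/
noncomputable def scal (s : ℝ) : PosDefMat 2 :=
  ⟨Real.exp s • 1, Matrix.PosDef.one.smul (Real.exp_pos s)⟩

theorem boost_val (s : ℝ) (n : UnitSphere) :
    (boost s n).1 = lorentz (Real.cosh s) (Real.sinh s • n.1) := rfl

theorem norm_unit (n : UnitSphere) : ‖n.1‖ = 1 := norm_eq_of_mem_sphere n

theorem scal_val (s : ℝ) : (scal s).1 = lorentz (Real.exp s) 0 := by
  have h := lorentz_smul (Real.exp s) 1 0
  rw [mul_one, smul_zero, lorentz_one_zero] at h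
  exact h.symm

theorem Det_of_eq_lorentz {A : PosDefMat 2} {a : ℝ} {v : Space} (h : A.1 = lorentz a v) :
    Det A = a ^ 2 - ‖v‖ ^ 2 := by
  rw [Det, h, det_lorentz, Complex.ofReal_re]

theorem exists_eq_lorentz (A : PosDefMat 2) : ∃ a v, A.1 = lorentz a v ∧ 0 < a := by
  obtain ⟨a, v, h⟩ := exists_lorentz A.2.isHermitian
  refine ⟨a, v, h, ?_⟩
  have h0 := (Complex.pos_iff.1 (A.2.diag_pos (i := 0))).1
  have h1 := (Complex.pos_iff.1 (A.2.diag_pos (i := 1))).1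
  rw [h] at h0 h1
  simp [lorentz] at h0 h1
  linarith

theorem Det_boost (s : ℝ) (n : UnitSphere) : Det (boost s n) = 1 := by
  rw [Det_of_eq_lorentz (boost_val s n), norm_smul, norm_unit, mul_one, Real.norm_eq_abs, sq_abs,
    Real.cosh_sq]
  ring

theorem Det_triple {n : ℕ} (A B : PosDefMat n) : Det (triple A B) = Det A ^ 2 * Det B := by
  have : ((Det (triple A B) : ℝ) : ℂ) = ((Det A ^ 2 * Det B : ℝ) : ℂ) := by
    push_cast
    rw [coe_Det, coe_Det, coe_Det]
    simp [triple, Matrix.det_mul]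
    ring
  exact_mod_cast this

/-- Polar coordinates on the positive definite matrices of determinant `1`. -/
theorem exists_boost {A : PosDefMat 2} (hA : Det A = 1) : ∃ s n, 0 ≤ s ∧ A = boost s n := by
  obtain ⟨a, v, h, ha⟩ := exists_eq_lorentz A
  rw [Det_of_eq_lorentz h] at hA
  have hc : Real.cosh (Real.arsinh ‖v‖) = a := by
    rw [Real.cosh_arsinh, Real.sqrt_eq_iff_mul_self_eq_of_pos ha]
    linarith
  by_cases hv : v = 0
  · refine ⟨0, ⟨EuclideanSpace.single 0 1, by simp⟩, le_rfl, Subtype.ext ?_⟩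
    rw [boost_val, h, ← hc]
    simp [hv]
  · have hv' : ‖v‖ ≠ 0 := norm_ne_zero_iff.2 hv
    refine ⟨Real.arsinh ‖v‖, ⟨‖v‖⁻¹ • v, by simp [norm_smul, hv']⟩,
      Real.arsinh_nonneg_iff.2 (norm_nonneg v), Subtype.ext ?_⟩
    rw [boost_val, h, hc, Real.sinh_arsinh, smul_smul, mul_inv_cancel₀ hv', one_smul]

/-- Any positive definite matrix is a positive scalar times a boost. -/
theorem exists_scal_mul_boost (A : PosDefMat 2) :
    ∃ s r n, Det A = Real.exp s ∧ A.1 = Real.exp (s / 2) • (boost r n).1 := by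
  have hd := Det_pos A
  set s := Real.log (Det A) with hs
  have hexp : Real.exp s = Det A := Real.exp_log hd
  have hsq : Real.exp (-(s / 2)) ^ 2 = (Det A)⁻¹ := by
    rw [← hexp, ← Real.exp_neg, ← Real.exp_nat_mul]; congr 1; push_cast; ring
  obtain ⟨a, v, h, ha⟩ := exists_eq_lorentz A
  have hB : (Real.exp (-(s / 2)) • A.1).PosDef := A.2.smul (Real.exp_pos _)
  have hBd : Det (⟨_, hB⟩ : PosDefMat 2) = 1 := by
    rw [Det_of_eq_lorentz (a := Real.exp (-(s / 2)) * a) (v := Real.exp (-(s / 2)) • v)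
      (by rw [lorentz_smul, ← h]), norm_smul, Real.norm_eq_abs, mul_pow, mul_pow, sq_abs, hsq,
      ← mul_sub, ← Det_of_eq_lorentz h, inv_mul_cancel₀ hd.ne']
  obtain ⟨r, n, -, hr⟩ := exists_boost hBd
  refine ⟨s, r, n, hexp.symm, ?_⟩
  rw [← hr]
  simp only [smul_smul, ← Real.exp_add]
  simp

theorem boost_zero (n : UnitSphere) : boost 0 n = scal 0 :=
  Subtype.ext <| by rw [boost_val, scal_val]; simp

theorem boost_neg (s : ℝ) (n : UnitSphere) : boost s (-n) = boost (-s) n :=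
  Subtype.ext <| by rw [boost_val, boost_val]; simp

theorem boost_injective {m n : UnitSphere} {s : ℝ} (hs : s ≠ 0) (h : boost s m = boost s n) :
    m = n := by
  have h' := (lorentz_inj (congrArg Subtype.val h)).2
  exact Subtype.ext (smul_right_injective _ (by simpa using hs) h')

theorem triple_boost (s t : ℝ) (n : UnitSphere) :
    triple (boost s n) (boost t n) = boost (2 * s + t) n := by
  apply Subtype.ext
  change (boost s n).1 * (boost t n).1 * (boost s n).1 = _
  rw [boost_val, boost_val, boost_val, lorentz_triple, norm_smul, real_inner_smul_left,
    real_inner_smul_right, real_inner_self_eq_norm_sq, norm_unit, Real.norm_eq_abs, mul_one, sq_abs,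
    Real.cosh_add, Real.sinh_add, Real.cosh_two_mul, Real.sinh_two_mul, smul_smul,
    smul_smul, ← add_smul]
  congr 1
  · ring
  · congr 1; ring

theorem triple_scal (s t : ℝ) : triple (scal s) (scal t) = scal (2 * s + t) := by
  apply Subtype.ext
  change (scal s).1 * (scal t).1 * (scal s).1 = _
  rw [scal_val, scal_val, scal_val, lorentz_triple, Real.exp_add,
    show Real.exp (2 * s) = Real.exp s ^ 2 by rw [← Real.exp_nat_mul]; norm_num]
  congr 1
  · simp
  · simp

theorem _root_.Continuous.boost {X : Type*} [TopologicalSpace X] {s : X → ℝ} {n : X → UnitSphere}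
    (hs : Continuous s) (hn : Continuous n) : Continuous fun x => JordanTriple.boost (s x) (n x) :=
  Continuous.subtype_mk (continuous_lorentz.comp ((Real.continuous_cosh.comp hs).prodMk
    ((Real.continuous_sinh.comp hs).smul (continuous_subtype_val.comp hn)))) _

theorem continuous_scal : Continuous scal :=
  Continuous.subtype_mk (by fun_prop) _

/-- Square roots are unique among positive definite matrices of determinant `1`. -/
theorem eq_of_triple_eq {A B : PosDefMat 2} (hA : Det A = 1) (hB : Det B = 1)
    (h : triple A (scal 0) = triple B (scal 0)) : A = B := by
  obtain ⟨a, v, ha, ha0⟩ := exists_eq_lorentz A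
  obtain ⟨b, w, hb, hb0⟩ := exists_eq_lorentz B
  rw [Det_of_eq_lorentz ha] at hA
  rw [Det_of_eq_lorentz hb] at hB
  have h' : A.1 * (scal 0).1 * A.1 = B.1 * (scal 0).1 * B.1 := congrArg Subtype.val h
  rw [ha, hb, scal_val, lorentz_triple, lorentz_triple] at h'
  obtain ⟨h1, h2⟩ := lorentz_inj h'
  simp at h1 h2
  have hab : a = b := by
    have : (a - b) * (a + b) = 0 := by nlinarith
    rcases mul_eq_zero.1 this with h | h <;> linarith
  subst hab
  have : v = w := smul_right_injective _ (by positivity : (2 * a : ℝ) ≠ 0) h2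
  subst this
  exact Subtype.ext (ha.trans hb.symm)

open Filter Topology Real

/-! ### Asymptotics of long products -/

/-- The hyperbolic law of cosines: `coshLaw a b u` is half the trace of the product of two boosts of
lengths `a` and `b` whose directions have inner product `u`. -/
noncomputable def coshLaw (a b u : ℝ) : ℝ := cosh a * cosh b + sinh a * sinh b * u

theorem tendsto_exp_neg_mul {a : ℝ} (ha : 0 < a) :
    Tendsto (fun t : ℝ => exp (-(a * t))) atTop (𝓝 0) :=
  tendsto_exp_neg_atTop_nhds_zero.comp (tendsto_id.const_mul_atTop ha)

theorem tendsto_cosh_mul_exp_neg {a : ℝ} (ha : 0 < a) :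
    Tendsto (fun t : ℝ => cosh (t * a) * exp (-(a * t))) atTop (𝓝 (1 / 2)) := by
  have h := (((tendsto_exp_neg_mul ha).pow 2).const_add 1).div_const 2
  simp only [ne_eq, OfNat.ofNat_ne_zero, not_false_eq_true, zero_pow, add_zero] at h
  refine h.congr fun t => ?_
  have : exp (t * a) * exp (-(a * t)) = 1 := by rw [← exp_add]; simp [mul_comm]
  rw [cosh_eq, mul_comm t a] at *
  linear_combination (-1 / 2) * this

theorem tendsto_sinh_mul_exp_neg {a : ℝ} (ha : 0 < a) :
    Tendsto (fun t : ℝ => sinh (t * a) * exp (-(a * t))) atTop (𝓝 (1 / 2)) := by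
  have h := (((tendsto_exp_neg_mul ha).pow 2).const_sub 1).div_const 2
  simp only [ne_eq, OfNat.ofNat_ne_zero, not_false_eq_true, zero_pow, sub_zero] at h
  refine h.congr fun t => ?_
  have : exp (t * a) * exp (-(a * t)) = 1 := by rw [← exp_add]; simp [mul_comm]
  rw [sinh_eq, mul_comm t a] at *
  linear_combination (-1 / 2) * this

theorem tendsto_coshLaw {a b : ℝ} (ha : 0 < a) (hb : 0 < b) (u : ℝ) :
    Tendsto (fun t : ℝ => coshLaw (t * a) (t * b) u * exp (-((a + b) * t))) atTop
      (𝓝 ((1 + u) / 4)) := by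
  have h := ((tendsto_cosh_mul_exp_neg ha).mul (tendsto_cosh_mul_exp_neg hb)).add
    (((tendsto_sinh_mul_exp_neg ha).mul (tendsto_sinh_mul_exp_neg hb)).mul_const u)
  rw [show (1 + u) / 4 = 1 / 2 * (1 / 2) + 1 / 2 * (1 / 2) * u by ring]
  refine h.congr fun t => ?_
  rw [coshLaw, show -((a + b) * t) = -(a * t) + -(b * t) by ring, exp_add]
  ring

/-- The length of a product of two long boosts differs from the sum of their lengths by a bounded
amount, whose limit depends on the angle between the directions. -/
theorem tendsto_length_sub {a b u : ℝ} (ha : 0 < a) (hb : 0 < b) (hu : -1 < u) {r : ℝ → ℝ}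
    (hr0 : ∀ t, 0 ≤ r t) (hr : ∀ t, cosh (r t) = coshLaw (t * a) (t * b) u) :
    Tendsto (fun t => r t - (a + b) * t) atTop (𝓝 (log ((1 + u) / 2))) := by
  have hab : 0 < a + b := by linarith
  have hsmall : Tendsto (fun t => exp (-r t) * exp (-((a + b) * t))) atTop (𝓝 0) :=
    squeeze_zero (fun t => by positivity)
      (fun t => mul_le_of_le_one_left (exp_pos _).le (exp_le_one_iff.2 (by linarith [hr0 t])))
      (tendsto_exp_neg_mul hab)
  have h := ((tendsto_coshLaw ha hb u).const_mul 2).sub hsmall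
  rw [show 2 * ((1 + u) / 4) - 0 = (1 + u) / 2 by ring] at h
  refine ((continuousAt_log (by linarith : (1 + u) / 2 ≠ 0)).tendsto.comp h).congr fun t => ?_
  have : 2 * (coshLaw (t * a) (t * b) u * exp (-((a + b) * t)))
      - exp (-r t) * exp (-((a + b) * t)) = exp (r t - (a + b) * t) := by
    rw [← hr, cosh_eq, sub_eq_add_neg (r t), exp_add]; ring
  simp only [Function.comp_apply, this, log_exp]

theorem tendsto_length_div {r : ℝ → ℝ} {a c : ℝ}
    (h : Tendsto (fun t => r t - a * t) atTop (𝓝 c)) :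
    Tendsto (fun t => r t / t) atTop (𝓝 a) := by
  have h' := (h.div_atTop tendsto_id).add_const a
  rw [zero_add] at h'
  refine h'.congr' ?_
  filter_upwards [eventually_gt_atTop 0] with t ht
  simp only [id]
  field_simp
  ring

theorem neg_one_lt_inner {m n : UnitSphere} (hmn : m ≠ -n) : -1 < inner ℝ m.1 n.1 := by
  refine lt_of_le_of_ne ?_ fun h => hmn (Subtype.ext
    ((inner_eq_neg_one_iff_of_norm_eq_one (norm_unit m) (norm_unit n)).1 h.symm))
  have := neg_le_of_abs_le (abs_real_inner_le_norm m.1 n.1)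
  rwa [norm_unit, norm_unit, one_mul] at this

theorem exists_inner_eq_zero (v : Space) : ∃ w : UnitSphere, inner ℝ v w.1 = 0 := by
  have h : LinearMap.ker (innerₛₗ ℝ v) ≠ ⊥ := LinearMap.ker_ne_bot_of_finrank_lt (by simp)
  obtain ⟨w, hw, hw0⟩ := Submodule.exists_mem_ne_zero_of_ne_bot h
  refine ⟨⟨‖w‖⁻¹ • w, by simp [norm_smul, hw0]⟩, ?_⟩
  have hw' : inner ℝ v w = 0 := hw
  simp [real_inner_smul_right, hw']

theorem ne_and_ne_neg_of_inner_eq_zero {m n : UnitSphere} (h : inner ℝ m.1 n.1 = 0) :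
    m ≠ n ∧ m ≠ -n := by
  constructor <;> rintro rfl <;> simp at h

/-- The length and the direction of `A B A` for boosts `A` and `B`: the two equations are the scalar
and the vector part of the matrix identity. -/
theorem triple_boost_boost {s t r : ℝ} {m n p : UnitSphere}
    (h : triple (boost s m) (boost t n) = boost r p) :
    cosh r = coshLaw (2 * s) t (inner ℝ m.1 n.1) ∧
      sinh r • p.1 = (2 * coshLaw s t (inner ℝ m.1 n.1) * sinh s) • m.1 + sinh t • n.1 := by
  have h' : (boost s m).1 * (boost t n).1 * (boost s m).1 = (boost r p).1 := congrArg Subtype.val h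
  rw [boost_val, boost_val, boost_val, lorentz_triple] at h'
  obtain ⟨h1, h2⟩ := lorentz_inj h'
  rw [norm_smul, real_inner_smul_left, real_inner_smul_right, norm_unit, Real.norm_eq_abs, mul_one,
    sq_abs] at h1
  rw [norm_smul, real_inner_smul_left, real_inner_smul_right, norm_unit, Real.norm_eq_abs, mul_one,
    sq_abs, cosh_sq, add_sub_cancel_left, one_smul, smul_smul] at h2
  refine ⟨?_, ?_⟩
  · rw [← h1, coshLaw, cosh_two_mul, sinh_two_mul]; ring
  · rw [← h2, coshLaw]; congr 2; ring

/-- If `m` and `n` are not opposite, then `A = boost (t / 2) m` and `B = boost t n` have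
`A B A = boost (r t) (p t)` where `r t` is `2 t` up to a bounded error and `p t` tends to `m`: the
outer factor decides the direction. -/
theorem exists_tendsto_triple {m n : UnitSphere} (hmn : m ≠ -n) :
    ∃ (r : ℝ → ℝ) (p : ℝ → UnitSphere),
      (∀ t, 0 ≤ r t) ∧
      (∀ t, triple (boost (t / 2) m) (boost t n) = boost (r t) (p t)) ∧
      Tendsto (fun t => r t - 2 * t) atTop (𝓝 (log ((1 + inner ℝ m.1 n.1) / 2))) ∧
      Tendsto p atTop (𝓝 m) := by
  have hu := neg_one_lt_inner hmn
  set u := inner ℝ m.1 n.1 with hu_def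
  have hex : ∀ t : ℝ, ∃ s q, 0 ≤ s ∧ triple (boost (t / 2) m) (boost t n) = boost s q := fun t =>
    exists_boost (by rw [Det_triple, Det_boost, Det_boost]; norm_num)
  choose r p hr0 hrp using hex
  have hcosh : ∀ t, cosh (r t) = coshLaw (t * 1) (t * 1) u := fun t => by
    rw [(triple_boost_boost (hrp t)).1, mul_one, mul_div_cancel₀ _ two_ne_zero]
  have hr := tendsto_length_sub one_pos one_pos hu hr0 hcosh
  rw [show (1 : ℝ) + 1 = 2 by norm_num] at hr
  refine ⟨r, p, hr0, hrp, hr, ?_⟩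
  have hL : 0 < (1 + u) / 4 := by linarith
  -- All vectors are rescaled by `exp (-2 t)`.
  have hC := tendsto_coshLaw one_pos one_pos u
  rw [show (1 : ℝ) + 1 = 2 by norm_num] at hC
  have hsmall : Tendsto (fun t => exp (-r t) * exp (-(2 * t))) atTop (𝓝 0) :=
    squeeze_zero (fun t => by positivity)
      (fun t => mul_le_of_le_one_left (exp_pos _).le (exp_le_one_iff.2 (by linarith [hr0 t])))
      (tendsto_exp_neg_mul two_pos)
  have hsinh : Tendsto (fun t => sinh (r t) * exp (-(2 * t))) atTop (𝓝 ((1 + u) / 4)) := by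
    have h := hC.sub hsmall
    rw [sub_zero] at h
    refine h.congr fun t => ?_
    rw [← hcosh, ← cosh_sub_sinh (r t)]; ring
  have hhalf : (0 : ℝ) < 1 / 2 := by norm_num
  have hm : Tendsto (fun t => 2 * coshLaw (t / 2) t u * sinh (t / 2) * exp (-(2 * t))) atTop
      (𝓝 ((1 + u) / 4)) := by
    have h := ((tendsto_coshLaw hhalf one_pos u).const_mul 2).mul (tendsto_sinh_mul_exp_neg hhalf)
    rw [show 2 * ((1 + u) / 4) * (1 / 2) = (1 + u) / 4 by ring] at h
    refine h.congr fun t => ?_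
    rw [show -(2 * t) = -((1 / 2 + 1) * t) + -(1 / 2 * t) by ring, exp_add, mul_one, mul_one_div]
    ring
  have hn : Tendsto (fun t => sinh t * exp (-(2 * t))) atTop (𝓝 0) := by
    have h := (tendsto_sinh_mul_exp_neg one_pos).mul (tendsto_exp_neg_mul one_pos)
    rw [mul_zero] at h
    refine h.congr fun t => ?_
    rw [mul_assoc, ← exp_add, mul_one]; congr 2; ring
  have hvec := (hsinh.inv₀ hL.ne').smul ((hm.smul_const m.1).add (hn.smul_const n.1))
  rw [zero_smul, add_zero, inv_smul_smul₀ hL.ne'] at hvec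
  refine tendsto_subtype_rng.2 (hvec.congr' ?_)
  filter_upwards [hsinh.eventually_ne hL.ne'] with t ht
  have h := (triple_boost_boost (hrp t)).2
  rw [← hu_def] at h
  have e : (2 * coshLaw (t / 2) t u * sinh (t / 2) * exp (-(2 * t))) • m.1
      + (sinh t * exp (-(2 * t))) • n.1 = (sinh (r t) * exp (-(2 * t))) • (p t).1 := by
    rw [mul_comm (sinh (r t)), mul_smul (exp _) (sinh (r t)), h]
    module
  rw [e, inv_smul_smul₀ ht]

/-! ### The determinant of the image -/

theorem eq_mul_of_continuous {h : ℝ → ℝ} (hc : Continuous h)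
    (hh : ∀ s t, h (2 * s + t) = 2 * h s + h t) (s : ℝ) : h s = s * h 1 := by
  have h0 : h 0 = 0 := by
    have := hh 0 0
    simp at this
    linarith
  have hadd : ∀ s t, h (s + t) = h s + h t := fun s t => by
    have h1 := hh (s / 2) t
    have h2 := hh (s / 2) 0
    rw [mul_div_cancel₀ s two_ne_zero] at h1 h2
    rw [add_zero, h0, add_zero] at h2
    rw [h1, h2]
  let f : ℝ →+ ℝ := ⟨⟨h, h0⟩, hadd⟩
  have := map_real_smul f hc s 1
  rw [smul_eq_mul, mul_one] at this
  exact this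

/-- The logarithm of the determinant of `φ A`. -/
noncomputable def logDet (φ : PosDefMat 2 → PosDefMat 2) (A : PosDefMat 2) : ℝ := log (Det (φ A))

theorem continuous_logDet {φ : PosDefMat 2 → PosDefMat 2} (hc : Continuous φ) :
    Continuous (logDet φ) := by
  have : Continuous fun A : PosDefMat 2 => Det (φ A) :=
    Complex.continuous_re.comp (Continuous.matrix_det (continuous_subtype_val.comp hc))
  exact this.log fun A => (Det_pos _).ne'

theorem logDet_triple {φ : PosDefMat 2 → PosDefMat 2} (hφ : IsJordanTripleEndomorphism φ)
    (A B : PosDefMat 2) : logDet φ (triple A B) = 2 * logDet φ A + logDet φ B := by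
  rw [logDet, hφ, Det_triple, log_mul (by have := Det_pos (φ A); positivity) (Det_pos _).ne',
    log_pow]
  rfl

theorem logDet_boost {φ : PosDefMat 2 → PosDefMat 2} (hc : Continuous φ)
    (hφ : IsJordanTripleEndomorphism φ) (s : ℝ) (n : UnitSphere) :
    logDet φ (boost s n) = s * logDet φ (boost 1 n) :=
  eq_mul_of_continuous (h := fun s => logDet φ (boost s n))
    ((continuous_logDet hc).comp (continuous_id.boost continuous_const))
    (fun s t => by rw [← triple_boost, logDet_triple hφ]) s

/-- The rate of `logDet φ` along `boost · n` does not depend on `n`: it is continuous in `n`, and the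
product `boost (t / 2) m * boost t n * boost (t / 2) m` has rate half the sum of the rates at `m`
and `n`, but direction tending to `m`. -/
theorem logDet_boost_eq {φ : PosDefMat 2 → PosDefMat 2} (hc : Continuous φ)
    (hφ : IsJordanTripleEndomorphism φ) {m n : UnitSphere} (hmn : m ≠ -n) :
    logDet φ (boost 1 m) = logDet φ (boost 1 n) := by
  obtain ⟨r, p, -, hrp, hr, hp⟩ := exists_tendsto_triple hmn
  have hγ : Continuous fun n => logDet φ (boost 1 n) :=
    (continuous_logDet hc).comp (continuous_const.boost continuous_id)
  have h := (tendsto_length_div hr).mul ((hγ.tendsto m).comp hp)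
  have h' : Tendsto (fun t => r t / t * logDet φ (boost 1 (p t))) atTop
      (𝓝 (logDet φ (boost 1 m) + logDet φ (boost 1 n))) := by
    refine tendsto_const_nhds.congr' ?_
    filter_upwards [eventually_gt_atTop 0] with t ht
    have e := congrArg (logDet φ) (hrp t)
    rw [logDet_triple hφ, logDet_boost hc hφ, logDet_boost hc hφ t, logDet_boost hc hφ (r t)] at e
    field_simp
    linarith
  have := tendsto_nhds_unique h h'
  linarith

theorem Det_map_boost {φ : PosDefMat 2 → PosDefMat 2} (hc : Continuous φ)
    (hφ : IsJordanTripleEndomorphism φ) (s : ℝ) (n : UnitSphere) : Det (φ (boost s n)) = 1 := by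
  obtain ⟨m, hm⟩ := exists_inner_eq_zero n.1
  obtain ⟨h1, h2⟩ := ne_and_ne_neg_of_inner_eq_zero hm
  have e1 := logDet_boost_eq hc hφ h2
  have e2 := logDet_boost_eq hc hφ (m := -n) (n := m) (fun h => h1 (neg_injective h))
  rw [boost_neg, logDet_boost hc hφ (-1)] at e2
  have e : logDet φ (boost s n) = 0 := by
    rw [logDet_boost hc hφ]
    have : logDet φ (boost 1 n) = 0 := by linarith
    rw [this, mul_zero]
  exact eq_one_of_pos_of_log_eq_zero (Det_pos _) e

theorem Det_map_scal_zero {φ : PosDefMat 2 → PosDefMat 2} (hc : Continuous φ)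
    (hφ : IsJordanTripleEndomorphism φ) : Det (φ (scal 0)) = 1 := by
  rw [← boost_zero ⟨EuclideanSpace.single 0 1, by simp⟩, Det_map_boost hc hφ]

/-! ### The image of a one-parameter group of boosts -/

theorem map_scal_zero {φ : PosDefMat 2 → PosDefMat 2} (hc : Continuous φ)
    (hφ : IsJordanTripleEndomorphism φ) : φ (scal 0) = scal 0 := by
  have h1 := Det_map_scal_zero hc hφ
  have h2 : Det (scal 0) = 1 := by rw [Det_of_eq_lorentz (scal_val 0)]; simp
  refine eq_of_triple_eq h1 h2 (Subtype.ext ?_)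
  have h3 : φ (scal 0) = triple (φ (scal 0)) (φ (scal 0)) := by
    rw [← hφ, triple_scal]; simp
  have h4 : (φ (scal 0)).1 = (φ (scal 0)).1 * (φ (scal 0)).1 * (φ (scal 0)).1 :=
    congrArg Subtype.val h3
  have hs : (scal 0).1 = 1 := by simp [scal]
  have h5 : (φ (scal 0)).1 * (φ (scal 0)).1 = 1 := by
    have := (φ (scal 0)).2.isUnit
    refine this.mul_right_cancel ?_
    rw [← h4, one_mul]
  change (φ (scal 0)).1 * (scal 0).1 * (φ (scal 0)).1 = (scal 0).1 * (scal 0).1 * (scal 0).1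
  simp [hs, h5]

/-- One-parameter groups of boosts are mapped to one-parameter groups of boosts. The parameters at
which this holds form a closed subgroup, which is closed under halving by uniqueness of square
roots. -/
theorem exists_map_boost {φ : PosDefMat 2 → PosDefMat 2} (hc : Continuous φ)
    (hφ : IsJordanTripleEndomorphism φ) (hi : Function.Injective φ) (n : UnitSphere) :
    ∃ k p, 0 < k ∧ ∀ s, φ (boost s n) = boost (s * k) p := by
  obtain ⟨k, p, hk, hkp⟩ := exists_boost (Det_map_boost hc hφ 1 n)
  have hhalf : ∀ s, φ (boost s n) = boost (s * k) p → φ (boost (s / 2) n) = boost (s / 2 * k) p := by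
    intro s hs
    refine eq_of_triple_eq (Det_map_boost hc hφ _ _) (Det_boost _ _) ?_
    have hzero := map_scal_zero hc hφ
    rw [← hzero, ← hφ, hzero, ← boost_zero n, triple_boost, boost_zero, ← boost_zero p,
      triple_boost, add_zero, mul_div_cancel₀ _ two_ne_zero, hs]
    congr 1; ring
  have htriple : ∀ s t, φ (boost s n) = boost (s * k) p → φ (boost t n) = boost (t * k) p →
      φ (boost (2 * s + t) n) = boost ((2 * s + t) * k) p := by
    intro s t hs ht
    rw [← triple_boost, hφ, hs, ht, triple_boost]
    congr 1; ring
  have hzero : φ (boost 0 n) = boost (0 * k) p := by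
    rw [zero_mul, boost_zero, boost_zero, map_scal_zero hc hφ]
  have hadd : ∀ s t, φ (boost s n) = boost (s * k) p → φ (boost t n) = boost (t * k) p →
      φ (boost (s + t) n) = boost ((s + t) * k) p := by
    intro s t hs ht
    have := htriple _ _ (hhalf s hs) ht
    rwa [mul_div_cancel₀ _ two_ne_zero] at this
  have hneg : ∀ s, φ (boost s n) = boost (s * k) p → φ (boost (-s) n) = boost (-s * k) p := by
    intro s hs
    -- `T X T = T` with `T = φ (boost s n)` determines `X`.
    have h1 : triple (φ (boost s n)) (φ (boost (-s) n)) = φ (boost s n) := by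
      rw [← hφ, triple_boost]; congr 2; ring
    have h2 : triple (boost (s * k) p) (boost (-s * k) p) = boost (s * k) p := by
      rw [triple_boost]; congr 1; ring
    rw [hs] at h1
    have h3 := congrArg Subtype.val (h1.trans h2.symm)
    have hu := (boost (s * k) p).2.isUnit
    exact Subtype.ext (hu.mul_left_cancel (hu.mul_right_cancel h3))
  let H : AddSubgroup ℝ :=
    { carrier := {s | φ (boost s n) = boost (s * k) p}
      zero_mem' := hzero
      add_mem' := fun {s t} hs ht => hadd s t hs ht
      neg_mem' := fun {s} hs => hneg s hs }
  have hclosed : IsClosed (H : Set ℝ) :=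
    isClosed_eq (hc.comp (continuous_id.boost continuous_const))
      ((continuous_mul_const k).boost continuous_const)
  have hpow : ∀ j : ℕ, (1 / 2 : ℝ) ^ j ∈ H := by
    intro j
    induction j with
    | zero =>
      show φ (boost ((1 / 2) ^ 0) n) = boost ((1 / 2) ^ 0 * k) p
      rw [pow_zero, one_mul, hkp]
    | succ j ih =>
      have := hhalf _ ih
      rwa [div_eq_mul_one_div, ← pow_succ] at this
  have hdense : Dense (H : Set ℝ) := H.dense_of_not_isolated_zero fun ε hε => by
    obtain ⟨j, hj⟩ := exists_pow_lt_of_lt_one hε (by norm_num : (1 / 2 : ℝ) < 1)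
    exact ⟨_, hpow j, by positivity, hj⟩
  have hall : ∀ s, φ (boost s n) = boost (s * k) p := fun s => by
    have : s ∈ (H : Set ℝ) := by
      rw [← hclosed.closure_eq, hdense.closure_eq]; trivial
    exact this
  refine ⟨k, p, lt_of_le_of_ne hk fun h0 => ?_, hall⟩
  have h1 : φ (boost 1 n) = φ (boost 0 n) := by rw [hall, hall, ← h0, mul_zero, mul_zero]
  have h2 := (lorentz_inj (congrArg Subtype.val (hi h1))).1
  rw [cosh_zero] at h2
  exact (one_lt_cosh.2 one_ne_zero).ne' h2

/-! ### The induced map of directions is an isometry -/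

/-- `φ` maps the one-parameter group of boosts in direction `n` to that in direction `f n`,
multiplying lengths by `k n`. -/
def MapsBoosts (φ : PosDefMat 2 → PosDefMat 2) (k : UnitSphere → ℝ) (f : UnitSphere → UnitSphere) :
    Prop :=
  ∀ n, 0 < k n ∧ ∀ s, φ (boost s n) = boost (s * k n) (f n)

theorem cosh_inj_of_nonneg {x y : ℝ} (hx : 0 ≤ x) (hy : 0 ≤ y) (h : cosh x = cosh y) : x = y := by
  rw [← arcosh_cosh hx, h, arcosh_cosh hy]

section

variable {φ : PosDefMat 2 → PosDefMat 2} {k : UnitSphere → ℝ} {f : UnitSphere → UnitSphere}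

theorem MapsBoosts.continuous_rate (h : MapsBoosts φ k f) (hc : Continuous φ) : Continuous k := by
  have hk : ∀ n, (φ (boost 1 n)).1.trace.re / 2 = cosh (k n) := fun n => by
    rw [(h n).2, boost_val, Matrix.trace_fin_two]
    simp [lorentz]
  have hcosh : Continuous fun n => cosh (k n) := by
    simp only [← hk]
    refine (Complex.continuous_re.comp (Continuous.matrix_trace ?_)).div_const 2
    exact continuous_subtype_val.comp (hc.comp (continuous_const.boost continuous_id))
  refine (continuousOn_arcosh.comp_continuous hcosh fun n => one_le_cosh _).congr fun n => ?_
  exact arcosh_cosh (h n).1.le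

theorem MapsBoosts.ne_neg (h : MapsBoosts φ k f) (hi : Function.Injective φ) {m n : UnitSphere}
    (hmn : m ≠ -n) : f m ≠ -f n := by
  intro hf
  have hn := (h n).1
  have e : φ (boost 1 m) = φ (boost (-(k m / k n)) n) := by
    rw [(h m).2, (h n).2, hf, boost_neg]
    congr 1; field_simp
  have e1 := hi e
  have e2 := (lorentz_inj (congrArg Subtype.val e1)).1
  rw [cosh_neg] at e2
  rw [← cosh_inj_of_nonneg zero_le_one (div_pos (h m).1 hn).le e2, ← boost_neg] at e1
  exact hmn (boost_injective one_ne_zero e1)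

theorem MapsBoosts.map_neg {K : ℝ} (h : MapsBoosts φ (fun _ => K) f) (n : UnitSphere) :
    f (-n) = -f n := by
  refine boost_injective (h n).1.ne' ?_
  have e := (h (-n)).2 1
  have e' := (h n).2 (-1)
  rw [boost_neg, e'] at e
  rw [boost_neg]
  simpa using e.symm

/-- The asymptotics of a product of long boosts, transported by `φ`. -/
theorem MapsBoosts.exists_tendsto (h : MapsBoosts φ k f) (hφ : IsJordanTripleEndomorphism φ)
    (hi : Function.Injective φ) {m n : UnitSphere} (hmn : m ≠ -n) :
    ∃ (r : ℝ → ℝ) (p : ℝ → UnitSphere),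
      Tendsto (fun t => r t - 2 * t) atTop (𝓝 (log ((1 + inner ℝ m.1 n.1) / 2))) ∧
      Tendsto p atTop (𝓝 m) ∧
      Tendsto (fun t => r t * k (p t) - (k m + k n) * t) atTop
        (𝓝 (log ((1 + inner ℝ (f m).1 (f n).1) / 2))) := by
  obtain ⟨r, p, hr0, hrp, hr, hp⟩ := exists_tendsto_triple hmn
  refine ⟨r, p, hr, hp, tendsto_length_sub (h m).1 (h n).1 (neg_one_lt_inner (h.ne_neg hi hmn))
    (fun t => mul_nonneg (hr0 t) (h _).1.le) fun t => ?_⟩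
  have e := congrArg φ (hrp t)
  rw [hφ, (h m).2, (h n).2, (h _).2] at e
  rw [(triple_boost_boost e).1]
  congr 1
  ring

/-- The stretching factor is the same for non-opposite directions: the direction of
`boost (t / 2) m * boost t n * boost (t / 2) m` tends to `m`, while its length is stretched by
asymptotically the mean of `k m` and `k n`. -/
theorem MapsBoosts.rate_eq_of_ne_neg (h : MapsBoosts φ k f) (hc : Continuous φ)
    (hφ : IsJordanTripleEndomorphism φ) (hi : Function.Injective φ) {m n : UnitSphere}
    (hmn : m ≠ -n) : k m = k n := by
  obtain ⟨r, p, hr, hp, hrk⟩ := h.exists_tendsto hφ hi hmn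
  have h1 := tendsto_length_div hrk
  have h2 := (tendsto_length_div hr).mul (((h.continuous_rate hc).tendsto m).comp hp)
  have := tendsto_nhds_unique h1 (h2.congr fun t => by simp only [Function.comp_apply]; ring)
  linarith

theorem MapsBoosts.rate_eq (h : MapsBoosts φ k f) (hc : Continuous φ)
    (hφ : IsJordanTripleEndomorphism φ) (hi : Function.Injective φ) (m n : UnitSphere) :
    k m = k n := by
  by_cases hmn : m = -n
  · obtain ⟨w, hw⟩ := exists_inner_eq_zero n.1
    obtain ⟨h1, h2⟩ := ne_and_ne_neg_of_inner_eq_zero hw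
    rw [h.rate_eq_of_ne_neg hc hφ hi h2]
    exact h.rate_eq_of_ne_neg hc hφ hi fun e => h1 (neg_injective (hmn.symm.trans e))
  · exact h.rate_eq_of_ne_neg hc hφ hi hmn

/-- The length of a product of long boosts has the bounded correction term
`log ((1 + ⟪m, n⟫) / 2)`, and a homothety of factor `K` multiplies this term by `K`. -/
theorem MapsBoosts.mul_log_eq {K : ℝ} (h : MapsBoosts φ (fun _ => K) f)
    (hφ : IsJordanTripleEndomorphism φ) (hi : Function.Injective φ) {m n : UnitSphere}
    (hmn : m ≠ -n) :
    K * log ((1 + inner ℝ m.1 n.1) / 2) = log ((1 + inner ℝ (f m).1 (f n).1) / 2) := by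
  obtain ⟨r, p, hr, -, hrk⟩ := h.exists_tendsto hφ hi hmn
  exact tendsto_nhds_unique (hr.const_mul K) (hrk.congr fun t => by ring)

/-- Hyperbolic space admits no homothety of factor other than `1`. -/
theorem MapsBoosts.rate_eq_one {K : ℝ} (h : MapsBoosts φ (fun _ => K) f)
    (hφ : IsJordanTripleEndomorphism φ) (hi : Function.Injective φ) : K = 1 := by
  let m : UnitSphere := ⟨EuclideanSpace.single 0 1, by simp⟩
  obtain ⟨n, hn⟩ := exists_inner_eq_zero m.1
  have hmn := ne_and_ne_neg_of_inner_eq_zero hn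
  have hmn' : m ≠ -(-n) := by simpa using hmn.1
  have e1 := h.mul_log_eq hφ hi hmn.2
  have e2 := h.mul_log_eq hφ hi hmn'
  have p1 := neg_one_lt_inner (h.ne_neg hi hmn.2)
  have p2 := neg_one_lt_inner (h.ne_neg hi hmn')
  -- The directions `n` and `-n` are both orthogonal to `m`, so the images of `n` and `-n` make the
  -- same angle with the image of `m`, which is therefore a right angle.
  rw [h.map_neg] at e2 p2
  simp only [Metric.sphere, hn, inner_neg_right, neg_zero, coe_neg_sphere] at e1 e2 p2
  have e := log_injOn_pos (Set.mem_Ioi.2 (by linarith)) (Set.mem_Ioi.2 (by linarith))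
    (e1.symm.trans e2)
  have hzero : inner ℝ (f m).1 (f n).1 = 0 := by linarith
  rw [hzero] at e1
  exact mul_right_cancel₀ (log_neg (by norm_num) (by norm_num)).ne (e1.trans (one_mul _).symm)

theorem MapsBoosts.inner_map (h : MapsBoosts φ (fun _ => 1) f)
    (hφ : IsJordanTripleEndomorphism φ) (hi : Function.Injective φ) (m n : UnitSphere) :
    inner ℝ (f m).1 (f n).1 = inner ℝ m.1 n.1 := by
  by_cases hmn : m = -n
  · rw [hmn, h.map_neg]
    simp
  · have e := h.mul_log_eq hφ hi hmn
    have p1 := neg_one_lt_inner hmn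
    have p2 := neg_one_lt_inner (h.ne_neg hi hmn)
    rw [one_mul] at e
    have := log_injOn_pos (Set.mem_Ioi.2 (by linarith)) (Set.mem_Ioi.2 (by linarith)) e
    linarith

end

/-- On the matrices of determinant `1`, an injective continuous Jordan triple endomorphism preserves
lengths and acts on directions by an isometry. -/
theorem exists_map_boost_isometry {φ : PosDefMat 2 → PosDefMat 2} (hc : Continuous φ)
    (hφ : IsJordanTripleEndomorphism φ) (hi : Function.Injective φ) :
    ∃ f : UnitSphere → UnitSphere, (∀ s n, φ (boost s n) = boost s (f n)) ∧
      ∀ m n, inner ℝ (f m).1 (f n).1 = inner ℝ m.1 n.1 := by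
  choose k f hk hf using exists_map_boost hc hφ hi
  have h : MapsBoosts φ k f := fun n => ⟨hk n, hf n⟩
  have hconst : k = fun _ => k ⟨EuclideanSpace.single 0 1, by simp⟩ :=
    funext fun n => h.rate_eq hc hφ hi n _
  rw [hconst] at h
  have h1 := h.rate_eq_one hφ hi
  rw [h1] at h
  exact ⟨f, fun s n => by rw [(h n).2, mul_one], h.inner_map hφ hi⟩

/-! ### Scalar matrices -/

theorem triple_scal_left (s : ℝ) (A : PosDefMat 2) :
    (triple (scal s) A).1 = exp (2 * s) • A.1 := by
  change (scal s).1 * A.1 * (scal s).1 = _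
  rw [two_mul, exp_add, mul_smul]
  simp [scal]

/-- A positive definite `T` such that `T D² T = D T² D` for all `D` is scalar: it suffices to take
for `D` a boost in a direction orthogonal to the vector part of `T`. -/
theorem eq_zero_of_triple_comm {T : PosDefMat 2} {a : ℝ} {v : Space} (hT : T.1 = lorentz a v)
    (h : ∀ n, triple T (triple (boost 1 n) (scal 0)) = triple (boost 1 n) (triple T (scal 0))) :
    v = 0 := by
  obtain ⟨n, hn⟩ := exists_inner_eq_zero v
  have e : T.1 * ((boost 1 n).1 * (scal 0).1 * (boost 1 n).1) * T.1 =
      (boost 1 n).1 * (T.1 * (scal 0).1 * T.1) * (boost 1 n).1 := congrArg Subtype.val (h n)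
  have ha : a ≠ 0 := by
    obtain ⟨b, w, hb, hb0⟩ := exists_eq_lorentz T
    rw [(lorentz_inj (hT.symm.trans hb)).1]
    exact hb0.ne'
  rw [hT, boost_val, scal_val] at e
  simp only [lorentz_triple] at e
  have e2 := congrArg (fun x => inner ℝ v x) (lorentz_inj e).2
  have hn' : inner ℝ n.1 v = 0 := by rw [real_inner_comm]; exact hn
  simp [inner_add_right, real_inner_smul_left, real_inner_smul_right, hn, hn', norm_smul] at e2
  refine e2.resolve_left fun e3 => ?_
  have hs : 0 < sinh 1 ^ 2 := pow_pos (sinh_pos_iff.2 one_pos) 2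
  have e4 : a * (2 * sinh 1 ^ 2) = 0 := by
    rw [cosh_sq] at e3
    linear_combination e3
  exact mul_ne_zero ha (by linarith) e4

/-- Automorphisms map scalar matrices to scalar matrices. -/
theorem exists_map_scal {φ : PosDefMat 2 → PosDefMat 2} (hc : Continuous φ)
    (hφ : IsJordanTripleAutomorphism φ) :
    ∃ γ : ℝ, γ ≠ 0 ∧ ∀ s, φ (scal s) = scal (s * γ) := by
  obtain ⟨hφ, hbij⟩ := hφ
  have hval : ∀ s, φ (scal s) = scal (logDet φ (scal s) / 2) := by
    intro s
    obtain ⟨a, v, h, ha⟩ := exists_eq_lorentz (φ (scal s))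
    have hv : v = 0 := by
      refine eq_zero_of_triple_comm h fun n => ?_
      obtain ⟨D, hD⟩ := hbij.2 (boost 1 n)
      rw [← hD, ← map_scal_zero hc hφ, ← hφ, ← hφ, ← hφ, ← hφ]
      congr 1
      apply Subtype.ext
      rw [triple_scal_left, triple_scal]
      change exp (2 * s) • (D.1 * (scal 0).1 * D.1) = D.1 * (scal (2 * s + 0)).1 * D.1
      simp [scal]
    subst hv
    have hd := Det_of_eq_lorentz h
    refine Subtype.ext ?_
    rw [h, scal_val, logDet, hd]
    simp [exp_log ha]
  have hlin := eq_mul_of_continuous (h := fun s => logDet φ (scal s))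
    ((continuous_logDet hc).comp continuous_scal)
    (fun s t => by rw [← triple_scal, logDet_triple hφ])
  have hall : ∀ s, φ (scal s) = scal (s * (logDet φ (scal 1) / 2)) := fun s => by
    rw [hval, hlin, mul_div_assoc]
  refine ⟨_, fun h0 => ?_, hall⟩
  have e : φ (scal 1) = φ (scal 0) := by rw [hall, hall, h0, mul_zero, mul_zero]
  have e1 := congrArg Subtype.val (hbij.1 e)
  rw [scal_val, scal_val] at e1
  exact one_ne_zero (exp_injective (lorentz_inj e1).1)

/-! ### Orthogonal transformations as unitary conjugations -/

theorem lorentz_mul_neg (a : ℝ) (v : Space) :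
    lorentz a v * lorentz a (-v) = (a ^ 2 - ‖v‖ ^ 2) • (1 : Matrix (Fin 2) (Fin 2) ℂ) := by
  rw [norm_sq_coord]
  ext i j
  fin_cases i <;> fin_cases j <;>
    simp [lorentz, Matrix.mul_apply, Complex.ext_iff, pow_two] <;> constructor <;> ring

/-- A reflection is, up to sign, conjugation by a traceless unitary matrix. -/
theorem exists_conj_reflection (u : Space) :
    ∃ U ∈ Matrix.specialUnitaryGroup (Fin 2) ℂ, ∃ ε : ℝ, (ε = 1 ∨ ε = -1) ∧
      ∀ v, U * lorentz 0 v * Uᴴ = lorentz 0 (ε • (ℝ ∙ u)ᗮ.reflection v) := by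
  by_cases hu : u = 0
  · refine ⟨1, one_mem _, 1, Or.inl rfl, fun v => ?_⟩
    rw [Submodule.reflection_orthogonal_apply, hu]
    simp
  have hu' : ‖u‖ ≠ 0 := norm_ne_zero_iff.2 hu
  set w : Space := ‖u‖⁻¹ • u with hw
  have hwn : ‖w‖ = 1 := by simp [hw, norm_smul, hu']
  have hconj : (Complex.I • lorentz 0 w)ᴴ = -Complex.I • lorentz 0 w := by
    rw [Matrix.conjTranspose_smul, (lorentz_isHermitian 0 w).eq]
    simp
  refine ⟨Complex.I • lorentz 0 w, ?_, -1, Or.inr rfl, fun v => ?_⟩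
  · have hsq : lorentz 0 w * lorentz 0 w = 1 := by
      have := lorentz_triple 0 1 w 0
      rw [lorentz_one_zero, mul_one] at this
      rw [this, ← lorentz_one_zero]
      simp [hwn]
    rw [Matrix.mem_specialUnitaryGroup_iff, Matrix.mem_unitaryGroup_iff, Matrix.star_eq_conjTranspose,
      hconj]
    refine ⟨?_, ?_⟩
    · simp [hsq, smul_smul]
    · simp [det_lorentz, hwn]
  · rw [hconj, Submodule.reflection_orthogonal_apply, Submodule.reflection_singleton_apply]
    simp only [Matrix.smul_mul, Matrix.mul_smul, smul_smul, lorentz_triple]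
    simp only [neg_mul, Complex.I_mul_I, neg_neg, one_smul]
    congr 1
    · simp
    · rw [hwn, hw, real_inner_smul_left, smul_smul]
      simp only [RCLike.ofReal_real_eq_id, id]
      match_scalars <;> field_simp <;> simp

/-- The double cover of the rotation group by `SU(2)`, extended to all orthogonal transformations:
since the reflections generate the orthogonal group, any element is a conjugation up to sign. -/
theorem exists_conj_isometry (g : Space ≃ₗᵢ[ℝ] Space) :
    ∃ U ∈ Matrix.specialUnitaryGroup (Fin 2) ℂ, ∃ ε : ℝ, (ε = 1 ∨ ε = -1) ∧
      ∀ v, U * lorentz 0 v * Uᴴ = lorentz 0 (ε • g v) := by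
  obtain ⟨l, -, rfl⟩ := g.reflections_generate_dim
  induction l with
  | nil => exact ⟨1, one_mem _, 1, Or.inl rfl, fun v => by simp⟩
  | cons u l ih =>
    obtain ⟨U, hU, ε, hε, h⟩ := ih
    obtain ⟨V, hV, δ, hδ, h'⟩ := exists_conj_reflection u
    refine ⟨V * U, mul_mem hV hU, δ * ε, ?_, fun v => ?_⟩
    · rcases hε with rfl | rfl <;> rcases hδ with rfl | rfl <;> norm_num
    · rw [Matrix.conjTranspose_mul, show V * U * lorentz 0 v * (Uᴴ * Vᴴ) =
        V * (U * lorentz 0 v * Uᴴ) * Vᴴ by simp only [Matrix.mul_assoc], h, h', map_smul, smul_smul]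
      rfl

/-- An inner product preserving map of the unit sphere extends to a linear isometry. -/
theorem exists_linearIsometryEquiv {f : UnitSphere → UnitSphere}
    (hf : ∀ m n, inner ℝ (f m).1 (f n).1 = inner ℝ m.1 n.1) :
    ∃ g : Space ≃ₗᵢ[ℝ] Space, ∀ n, (f n).1 = g n.1 := by
  let e : Fin 3 → UnitSphere := fun i => ⟨EuclideanSpace.single i 1, by simp⟩
  let b : OrthonormalBasis (Fin 3) ℝ Space := EuclideanSpace.basisFun (Fin 3) ℝ
  have hb : ∀ i, b i = (e i).1 := fun i => by simp [b, e]
  have ho : Orthonormal ℝ fun i => (f (e i)).1 := by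
    rw [orthonormal_iff_ite]
    intro i j
    rw [hf, ← hb, ← hb]
    exact orthonormal_iff_ite.1 b.orthonormal i j
  let c : OrthonormalBasis (Fin 3) ℝ Space := OrthonormalBasis.mk ho
    (ho.linearIndependent.span_eq_top_of_card_eq_finrank (by simp)).ge
  have hcf : ∀ i, c i = (f (e i)).1 := fun i => by simp [c]
  refine ⟨b.equiv c (Equiv.refl _), fun n => c.repr.injective ?_⟩
  ext i
  rw [c.repr_apply_apply, c.repr_apply_apply, hcf, hf, ← hcf, ← hb]
  have : c i = b.equiv c (Equiv.refl _) (b i) := by simp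
  rw [this, LinearIsometryEquiv.inner_map_map]

theorem lorentz_conj {U : Matrix (Fin 2) (Fin 2) ℂ} (hU : U ∈ Matrix.specialUnitaryGroup (Fin 2) ℂ)
    {v w : Space} (h : U * lorentz 0 v * Uᴴ = lorentz 0 w) (a : ℝ) :
    U * lorentz a v * Uᴴ = lorentz a w := by
  have hUU : U * Uᴴ = 1 :=
    Matrix.mem_unitaryGroup_iff.1 (Matrix.mem_specialUnitaryGroup_iff.1 hU).1
  have hsplit : ∀ x, lorentz a x = a • (1 : Matrix (Fin 2) (Fin 2) ℂ) + lorentz 0 x := fun x => by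
    rw [← lorentz_one_zero, ← lorentz_smul, ← lorentz_add]
    simp
  rw [hsplit, hsplit, Matrix.mul_add, Matrix.add_mul, h]
  simp [hUU]

end JordanTriple

open JordanTriple in
theorem theorem2 (φ : JordanTriple.PosDefMat 2 → JordanTriple.PosDefMat 2)
    (hcont : Continuous φ) (hφ : JordanTriple.IsJordanTripleAutomorphism φ) :
    (∃ c : ℝ, c ≠ -1 / 2 ∧ ∃ U ∈ Matrix.specialUnitaryGroup (Fin 2) ℂ,
      ∀ A : JordanTriple.PosDefMat 2,
        (φ A : Matrix (Fin 2) (Fin 2) ℂ) =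
          (JordanTriple.Det A ^ c) • (U * (A : Matrix (Fin 2) (Fin 2) ℂ) * Uᴴ)) ∨
    (∃ d : ℝ, d ≠ 1 / 2 ∧ ∃ V ∈ Matrix.specialUnitaryGroup (Fin 2) ℂ,
      ∀ A : JordanTriple.PosDefMat 2,
        (φ A : Matrix (Fin 2) (Fin 2) ℂ) =
          (JordanTriple.Det A ^ d) • (V * (A : Matrix (Fin 2) (Fin 2) ℂ)⁻¹ * Vᴴ)) := by
  obtain ⟨γ, hγ, hscal⟩ := exists_map_scal hcont hφ
  obtain ⟨f, hf, hinner⟩ := exists_map_boost_isometry hcont hφ.1 hφ.2.1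
  obtain ⟨g, hg⟩ := exists_linearIsometryEquiv hinner
  obtain ⟨U, hU, ε, hε, hconj⟩ := exists_conj_isometry g
  have hφA : ∀ (A : PosDefMat 2) (s r : ℝ) (n : UnitSphere),
      A.1 = Real.exp (s / 2) • (boost r n).1 →
      (φ A).1 = Real.exp (s * γ / 2) • (boost r (f n)).1 := by
    intro A s r n hA
    have e : A = triple (scal (s / 4)) (boost r n) := Subtype.ext <| by
      rw [triple_scal_left, hA]; congr 2; ring
    rw [e, hφ.1, hscal, hf, triple_scal_left]
    congr 2; ring
  rcases hε with rfl | rfl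
  · refine Or.inl ⟨(γ - 1) / 2, fun h => hγ (by linarith), U, hU, fun A => ?_⟩
    obtain ⟨s, r, n, hs, hA⟩ := exists_scal_mul_boost A
    have e : U * (boost r n).1 * Uᴴ = (boost r (f n)).1 := by
      rw [boost_val, boost_val, hg, ← map_smul]
      exact lorentz_conj hU (by rw [hconj, one_smul]) _
    rw [hφA A s r n hA, ← e, hs, hA, ← Real.exp_mul, Matrix.mul_smul, Matrix.smul_mul, smul_smul,
      ← Real.exp_add]
    congr 2; ring
  · refine Or.inr ⟨(γ + 1) / 2, fun h => hγ (by linarith), U, hU, fun A => ?_⟩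
    obtain ⟨s, r, n, hs, hA⟩ := exists_scal_mul_boost A
    have hinv : A.1⁻¹ = Real.exp (-(s / 2)) • lorentz (Real.cosh r) (-(Real.sinh r • n.1)) := by
      refine Matrix.inv_eq_right_inv ?_
      rw [hA, boost_val, Matrix.smul_mul, Matrix.mul_smul, lorentz_mul_neg, norm_smul, norm_unit,
        mul_one, Real.norm_eq_abs, sq_abs, Real.cosh_sq, add_sub_cancel_left, one_smul, smul_smul,
        ← Real.exp_add, add_neg_cancel, Real.exp_zero, one_smul]
    have e : U * lorentz (Real.cosh r) (-(Real.sinh r • n.1)) * Uᴴ = (boost r (f n)).1 := by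
      rw [boost_val, hg, ← map_smul]
      exact lorentz_conj hU (by rw [hconj, map_neg]; simp) _
    rw [hφA A s r n hA, ← e, hs, hinv, ← Real.exp_mul, Matrix.mul_smul, Matrix.smul_mul, smul_smul,
      ← Real.exp_add]
    congr 2; ring
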